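/- **Setting.** Let $\alpha\in(0,1)$, $\varsigma:=\alpha/2$, $m,\varepsilon,L,\beta>0$, $\kappa\ge 0$, let $M\ge1$ be an integer and $h:=L/M$. Let $D\subset\mathbb R$ be an open set containing $[-\beta,\beta]$, and let $F,f$ be real functions with $F'=-f$ on $D$, $f\in C^1(D)$, $f(\pm\beta)=0$, $f>0$ on $D\cap(-\infty,-\beta)$ and $f<0$ on $D\cap(\beta,\infty)$ (outside $D$ arbitrary values of $F,f$ are allowed). Let $V:\mathbb R\to\mathbb R$ satisfy: $V\in C^1(\mathbb R)\cap W^{2,\infty}(\mathbb R)$, $V(1)=1$, $V'(1)=0$, $|V'|\le K_1$ for some $K_1>0$; $0\le V\le 1$; and $|V(z_1)-1|\le|V(z_2)-1|$ whenever $|z_1-1|\le|z_2-1|$. Let $\mathbb V_h$ be the space of real grid functions $v=(v_{ij})$ that are $M$-periodic in both indices, with $\langle v,w\rangle=h^2\sum_{i,j=1}^M v_{ij}w_{ij}$, $\Delta_hv_{ij}=h^{-2}(v_{i+1,j}+v_{i-1,j}+v_{i,j+1}+v_{i,j-1}-4v_{ij})$, $\nabla_hv_{ij}=h^{-1}(v_{i+1,j}-v_{ij},\,v_{i,j+1}-v_{ij})$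 and $\|\nabla_h v\|^2=h^2\sum_{i,j=1}^M|\nabla_hv_{ij}|^2$. For $v\in\mathbb V_h$, $w\in\mathbb R$ put $E_{1h}[v]=\langle F(v),1\rangle$, $g_h(v,w)=e^{w}/e^{E_{1h}[v]}$ and $\mathcal E_h[v,w]=\frac{\varepsilon^2}{2}\|\nabla_hv\|^2+w$. Let $0=t_0<t_1<\dots<t_N$, $\tau_k=t_k-t_{k-1}$, $r_k=\tau_k/\tau_{k-1}$ for $k\ge2$, $t_{k-\theta}=(1-\theta)t_k+\theta t_{k-1}$, $\nabla_\tau v^k=v^k-v^{k-1}$, $\mathbb D_\tau v^k=\nabla_\tau v^k/\tau_k$, and $\omega_\mu(x)=x^{\mu-1}/\Gamma(\mu)$. The L2-$1_\sigma$ formula is $\tilde{\mathbb D}^\alpha_\tau v^n=\sum_{k=1}^nB^{(n)}_{n-k}\nabla_\tau v^k$, where $$a^{(n)}_{n-k}=\frac1{\tau_k}\int_{t_{k-1}}^{\min\{t_k,t_{n-\varsigma}\}}\omega_{1-\alpha}(t_{n-\varsigma}-s)\,ds\ (1\le k\le n),$$ $$b^{(n)}_{n-k}=\frac{2}{\tau_k(\tau_k+\tau_{k+1})}\int_{t_{k-1}}^{t_k}(s-t_{k-\frac12})\,\omega_{1-\alpha}(t_{n-\varsigma}-s)\,ds\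 (1\le k\le n-1),$$ $B^{(1)}_0=a^{(1)}_0$, and for $n\ge2$: $B^{(n)}_0=a^{(n)}_0+b^{(n)}_1/r_n$; $B^{(n)}_{n-k}=a^{(n)}_{n-k}+b^{(n)}_{n-k+1}/r_k-b^{(n)}_{n-k}$ for $2\le k\le n-1$; $B^{(n)}_{n-1}=a^{(n)}_{n-1}-b^{(n)}_{n-1}$. **Scheme.** The unbalanced L2-$1_\sigma$-sESAV scheme seeks $\hat\phi^n,\phi^n\in\mathbb V_h$ and $R^n\in\mathbb R$ ($0\le n\le N$), from given $\phi^0,R^0$, such that $\hat\phi^0=\phi^0$ and, with $\phi^{n-\varsigma}=(1-\varsigma)\phi^n+\varsigma\phi^{n-1}$, $\hat\phi^{n-\varsigma}=(1-\varsigma)\hat\phi^n+\varsigma\phi^{n-1}$, $V^{n-\varsigma}=V(g_h(\hat\phi^{n-\varsigma},R^{n-1}))$: * $B^{(1)}_0(\hat\phi^1-\phi^0)=m(\varepsilon^2\Delta_h\hat\phi^{1-\varsigma}+f(\hat\phi^{1-\varsigma}))$; * $\hat\phi^n=\min\{\max\{(1+r_n)\phi^{n-1}-r_n\phi^{n-2},-\beta\},\beta\}$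 for $2\le n\le N$; * for $1\le n\le N$, $$\tilde{\mathbb D}^\alpha_\tau\phi^n=m\big(\varepsilon^2\Delta_h\phi^{n-\varsigma}+V^{n-\varsigma}f(\hat\phi^{n-\varsigma})-\kappa(\phi^{n-\varsigma}-V^{n-\varsigma}\hat\phi^{n-\varsigma})\big),$$ $$\mathbb D_\tau R^n=-V^{n-\varsigma}\langle f(\hat\phi^{n-\varsigma}),\mathbb D_\tau\phi^n\rangle+\kappa\langle\phi^{n-\varsigma}-V^{n-\varsigma}\hat\phi^{n-\varsigma},\mathbb D_\tau\phi^n\rangle.$$ **Theorem.** Assume that $r_k\ge 4/7$ for $2\le k\le N$, that $\kappa\ge\max_{[-\beta,\beta]}|f'|$, and that $$\tau_1\le\Big(\frac{4}{11\,\varsigma m(\kappa+4\varepsilon^2/h^2)\Gamma(2-\alpha)}\Big)^{1/\alpha},\qquad \tau_1\le\Big(\frac{4}{11\,\kappa(1-\varsigma)m\,\Gamma(2-\alpha)}\Big)^{1/\alpha}$$ (the second condition being void if $\kappa=0$). Then every solution of the unbalanced L2-$1_\sigma$-sESAV scheme satisfies $$\mathcal E_h[\phi^n,R^n]\le\mathcal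 E_h[\phi^0,R^0]\qquad\text{for all }1\le n\le N.$$ -/

import Mathlib

open scoped ContDiff ENNReal

namespace SESAV

noncomputable section

/-! ### Periodic grid functions on the square and discrete operators -/

/-- `M`-periodic grid functions on the uniform grid with `M` cells in each direction. -/
abbrev Grid (M : ℕ) : Type := ZMod M → ZMod M → ℝ

/-- The grid length `L / M`. -/
def meshSize (L : ℝ) (M : ℕ) : ℝ := L / (M : ℝ)

/-- The discrete inner product `h² ∑ v w`. -/
def gridInner (L : ℝ) {M : ℕ} [NeZero M] (v w : Grid M) : ℝ :=
  meshSize L M ^ 2 * ∑ i : ZMod M, ∑ j : ZMod M, v i j * w i j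

/-- The five-point discrete Laplacian. -/
def discreteLaplacian (L : ℝ) {M : ℕ} (v : Grid M) : Grid M := fun i j =>
  (1 / meshSize L M ^ 2) *
    (v (i + 1) j + v (i - 1) j + v i (j + 1) + v i (j - 1) - 4 * v i j)

/-- First component of the discrete (forward difference) gradient. -/
def discreteGradX (L : ℝ) {M : ℕ} (v : Grid M) : Grid M := fun i j =>
  (v (i + 1) j - v i j) / meshSize L M

/-- Second component of the discrete (forward difference) gradient. -/
def discreteGradY (L : ℝ) {M : ℕ} (v : Grid M) : Grid M := fun i j =>
  (v i (j + 1) - v i j) / meshSize L M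

/-- The squared discrete `L²` norm of the discrete gradient. -/
def gradNormSq (L : ℝ) {M : ℕ} [NeZero M] (v : Grid M) : ℝ :=
  gridInner L (discreteGradX L v) (discreteGradX L v) +
    gridInner L (discreteGradY L v) (discreteGradY L v)

/-- Pointwise application of a real function to a grid function. -/
def applyFun (u : ℝ → ℝ) {M : ℕ} (v : Grid M) : Grid M := fun i j => u (v i j)

/-- `E_{1h}[v] = ⟨F(v), 1⟩`. -/
def potentialEnergy (L : ℝ) (F : ℝ → ℝ) {M : ℕ} [NeZero M] (v : Grid M) : ℝ :=
  gridInner L (applyFun F v) (fun _ _ => 1)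

/-- `g_h(v, w) = exp w / exp E_{1h}[v]`. -/
def expRatio (L : ℝ) (F : ℝ → ℝ) {M : ℕ} [NeZero M] (v : Grid M) (w : ℝ) : ℝ :=
  Real.exp w / Real.exp (potentialEnergy L F v)

/-- The modified discrete energy `ε²/2 ‖∇_h φ‖² + R`. -/
def modifiedEnergy (L ε : ℝ) {M : ℕ} [NeZero M] (φ : Grid M) (R : ℝ) : ℝ :=
  ε ^ 2 / 2 * gradNormSq L φ + R

/-! ### Time levels and the nonuniform L2-1σ formula -/

/-- Time levels `0 = t₀ < t₁ < ⋯ < t_N`; the final time is `t_N`. -/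
def IsTimeMesh (N : ℕ) (t : ℕ → ℝ) : Prop :=
  t 0 = 0 ∧ ∀ k, 1 ≤ k → k ≤ N → t (k - 1) < t k

/-- The time step `τ_k = t_k - t_{k-1}`, used for `k ≥ 1`. -/
def step (t : ℕ → ℝ) (k : ℕ) : ℝ := t k - t (k - 1)

/-- The adjacent time-step ratio `r_k = τ_k / τ_{k-1}`, used for `k ≥ 2`. -/
def ratio (t : ℕ → ℝ) (k : ℕ) : ℝ := step t k / step t (k - 1)

/-- The off-set time level `t_{k-s} = (1 - s) t_k + s t_{k-1}`, used for `k ≥ 1`. -/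
def offsetTime (s : ℝ) (t : ℕ → ℝ) (k : ℕ) : ℝ := (1 - s) * t k + s * t (k - 1)

/-- `ω_μ(x) = x^{μ-1} / Γ(μ)`. -/
def omegaKernel (μ x : ℝ) : ℝ := x ^ (μ - 1) / Real.Gamma μ

/-- `coeffA α t n k` is the coefficient `a^{(n)}_{n-k}`, for `1 ≤ k ≤ n`, with off-set `α / 2`. -/
def coeffA (α : ℝ) (t : ℕ → ℝ) (n k : ℕ) : ℝ :=
  1 / step t k *
    ∫ s in (t (k - 1))..(min (t k) (offsetTime (α / 2) t n)),
      omegaKernel (1 - α) (offsetTime (α / 2) t n - s)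

/-- `coeffB α t n k` is the coefficient `b^{(n)}_{n-k}`, for `1 ≤ k ≤ n - 1`, with
off-set `α / 2`. -/
def coeffB (α : ℝ) (t : ℕ → ℝ) (n k : ℕ) : ℝ :=
  2 / (step t k * (step t k + step t (k + 1))) *
    ∫ s in (t (k - 1))..(t k),
      (s - offsetTime (1 / 2) t k) * omegaKernel (1 - α) (offsetTime (α / 2) t n - s)

/-- `kernelB α t n k` is the L2-1σ convolution kernel `B^{(n)}_{n-k}`, for `1 ≤ k ≤ n`. -/
def kernelB (α : ℝ) (t : ℕ → ℝ) (n k : ℕ) : ℝ :=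
  if n = 1 then coeffA α t 1 1
  else if k = n then coeffA α t n n + coeffB α t n (n - 1) / ratio t n
  else if k = 1 then coeffA α t n 1 - coeffB α t n 1
  else coeffA α t n k + coeffB α t n (k - 1) / ratio t k - coeffB α t n k

/-- The nonuniform L2-1σ approximation `∑_{k=1}^n B^{(n)}_{n-k} (φ^k - φ^{k-1})` of the Caputo
derivative of order `α` at the off-set time `t_{n-α/2}`. -/
def fracDeriv (α : ℝ) (t : ℕ → ℝ) {M : ℕ} (φ : ℕ → Grid M) (n : ℕ) : Grid M :=
  ∑ k ∈ Finset.Icc 1 n, kernelB α t n k • (φ k - φ (k - 1))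

/-! ### The nonlinear potential and the auxiliary functional -/

/-- The potential `F` with `f = -F'` continuously differentiable on the (open) domain `D`, which
contains `[-β, β]`; `f` vanishes at `±β` and has the sign of the maximum-bound principle beyond.
The values of `F` and `f` outside `D` are irrelevant and unrestricted. -/
structure IsPotential (D : Set ℝ) (F f : ℝ → ℝ) (β : ℝ) : Prop where
  isOpen : IsOpen D
  beta_pos : 0 < β
  Icc_subset : Set.Icc (-β) β ⊆ D
  hasDerivAt : ∀ x ∈ D, HasDerivAt F (-f x) x
  contDiffOn : ContDiffOn ℝ 1 f D
  f_beta : f β = 0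
  f_neg_beta : f (-β) = 0
  pos_of_lt : ∀ x ∈ D, x < -β → 0 < f x
  neg_of_gt : ∀ x ∈ D, β < x → f x < 0

/-- `v` is the weak derivative of `u` on the real line. -/
def IsWeakDeriv (u v : ℝ → ℝ) : Prop :=
  MeasureTheory.LocallyIntegrable u ∧ MeasureTheory.LocallyIntegrable v ∧
    ∀ ψ : ℝ → ℝ, ContDiff ℝ ∞ ψ → HasCompactSupport ψ →
      ∫ x, u x * deriv ψ x = -∫ x, v x * ψ x

/-- `u` belongs to the Sobolev space `W^{2,∞}(ℝ)`. -/
def MemW2Infty (u : ℝ → ℝ) : Prop :=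
  ∃ u₁ u₂ : ℝ → ℝ, MeasureTheory.MemLp u ∞ MeasureTheory.volume ∧
    MeasureTheory.MemLp u₁ ∞ MeasureTheory.volume ∧
    MeasureTheory.MemLp u₂ ∞ MeasureTheory.volume ∧ IsWeakDeriv u u₁ ∧ IsWeakDeriv u₁ u₂

/-- The assumptions on the auxiliary functional `V`, with upper bound `K₂`: regularity and
normalisation at `1`; nonnegativity and boundedness; monotonicity away from `1`. -/
structure IsAuxiliary (V : ℝ → ℝ) (K₂ : ℝ) : Prop where
  contDiff : ContDiff ℝ 1 V
  memW2Infty : MemW2Infty V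
  at_one : V 1 = 1
  deriv_at_one : deriv V 1 = 0
  deriv_bound : ∃ K₁ : ℝ, 0 < K₁ ∧ ∀ z, |deriv V z| ≤ K₁
  nonneg : ∀ z, 0 ≤ V z
  le_bound : ∀ z, V z ≤ K₂
  mono : ∀ z₁ z₂ : ℝ, |z₁ - 1| ≤ |z₂ - 1| → |V z₁ - 1| ≤ |V z₂ - 1|

/-! ### The unbalanced stabilized scheme -/

/-- The weighted value `(1 - s) a + s b`. -/
def weighted (s : ℝ) {M : ℕ} (a b : Grid M) : Grid M := (1 - s) • a + s • b

/-- `φ̂^{n-ς} = (1 - ς) φ̂^n + ς φ^{n-1}` with `ς = α / 2`. -/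
def predMid (α : ℝ) {M : ℕ} (φhat φ : ℕ → Grid M) (n : ℕ) : Grid M :=
  weighted (α / 2) (φhat n) (φ (n - 1))

/-- `φ^{n-ς} = (1 - ς) φ^n + ς φ^{n-1}` with `ς = α / 2`. -/
def solMid (α : ℝ) {M : ℕ} (φ : ℕ → Grid M) (n : ℕ) : Grid M :=
  weighted (α / 2) (φ n) (φ (n - 1))

/-- `V^{n-ς} = V(g_h(φ̂^{n-ς}, R^{n-1}))`. -/
def auxValue (α L : ℝ) (F V : ℝ → ℝ) {M : ℕ} [NeZero M] (φhat φ : ℕ → Grid M) (R : ℕ → ℝ)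
    (n : ℕ) : ℝ :=
  V (expRatio L F (predMid α φhat φ n) (R (n - 1)))

/-- `(φ̂, φ, R)` is a solution, up to level `N`, of the unbalanced stabilized L2-1σ
exponential-SAV scheme. -/
structure IsUnbalancedSolution (α m ε β κ L : ℝ) (F f V : ℝ → ℝ) {M : ℕ} [NeZero M]
    (N : ℕ) (t : ℕ → ℝ) (φhat φ : ℕ → Grid M) (R : ℕ → ℝ) : Prop where
  /-- initialisation -/
  pred_zero : φhat 0 = φ 0
  /-- the fully implicit prediction at the first level -/
  pred_one : 1 ≤ N →
    kernelB α t 1 1 • (φhat 1 - φ 0) =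
      m • (ε ^ 2 • discreteLaplacian L (predMid α φhat φ 1) + applyFun f (predMid α φhat φ 1))
  /-- the cut-off linear extrapolation at the later levels -/
  pred_succ : ∀ n, 2 ≤ n → n ≤ N → ∀ i j,
    φhat n i j =
      min (max ((1 + ratio t n) * φ (n - 1) i j - ratio t n * φ (n - 2) i j) (-β)) β
  /-- the equation for the phase field -/
  phase_eq : ∀ n, 1 ≤ n → n ≤ N →
    fracDeriv α t φ n =
      m • (ε ^ 2 • discreteLaplacian L (solMid α φ n)
        + auxValue α L F V φhat φ R n • applyFun f (predMid α φhat φ n)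
        - κ • (solMid α φ n - auxValue α L F V φhat φ R n • predMid α φhat φ n))
  /-- the equation for the auxiliary variable -/
  aux_eq : ∀ n, 1 ≤ n → n ≤ N →
    (R n - R (n - 1)) / step t n =
      -auxValue α L F V φhat φ R n *
          gridInner L (applyFun f (predMid α φhat φ n)) ((1 / step t n) • (φ n - φ (n - 1)))
        + κ * gridInner L
            (solMid α φ n - auxValue α L F V φhat φ R n • predMid α φhat φ n)
            ((1 / step t n) • (φ n - φ (n - 1)))

end

end SESAV

/-! Test the phase equation with the increment `φ (n + 1) - φ n` and add the equation for `R`. The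
contributions of `V`, `f` and `κ` cancel exactly, and the Laplacian at the off-set level dissipates
because `α / 2 ≤ 1 / 2`. One step therefore changes the energy by at most `-1 / m` times the inner
product of the fractional derivative with the increment (`energy_step`). After summation over the
levels, everything reduces to positive semidefiniteness of the lower triangular L2-1σ kernel
(`sum_kernelB_nonneg`).

By `sum_lower_triangular_nonneg`, this follows from three inequalities: each row increases towards
the diagonal, the increments along a row shrink from one row to the next, and the diagonal entry is
large enough. Every off-diagonal entry is a linear functional `kernelRow` of the weakly singular
kernel, and for any nonnegative, increasing, convex `K` the value `K (t k)` separates `kernelRow t K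
k` from `kernelRow t K (k + 1)`. This applies to the kernel of one row and also to the difference of
the kernels of two consecutive rows, giving the first two inequalities. The third uses the explicit
diagonal integral. The bound `4 / 7` on the step ratios enters in `mean_add_moment_le` and in
`offsetKernel_succ_le`. -/

namespace SESAV

/-! ### Moments and means of convex kernels. -/

/-- Nonnegative, nondecreasing and convex on the half line `(-∞, c)`. -/
structure IsConvexKernel (K : ℝ → ℝ) (c : ℝ) : Prop where
  nonneg : ∀ s < c, 0 ≤ K s
  monotoneOn : MonotoneOn K (Set.Iio c)
  convexOn : ConvexOn ℝ (Set.Iio c) K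

namespace IsConvexKernel

variable {K : ℝ → ℝ} {c a b : ℝ}

lemma continuousOn (hK : IsConvexKernel K c) : ContinuousOn K (Set.Iio c) :=
  hK.convexOn.continuousOn isOpen_Iio

lemma continuousOn_Icc (hK : IsConvexKernel K c) (hb : b < c) : ContinuousOn K (Set.Icc a b) :=
  hK.continuousOn.mono fun _ hx => lt_of_le_of_lt hx.2 hb

/-- The first moment about the midpoint of a monotone function is nonnegative. -/
lemma moment_nonneg (hK : IsConvexKernel K c) (hab : a ≤ b) (hb : b < c) :
    0 ≤ ∫ s in a..b, (s - (a + b) / 2) * K s := by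
  have hc := hK.continuousOn_Icc (a := a) hb
  -- Constants have zero first moment, so `K` may be compared with its midpoint value, where the two
  -- factors have equal sign.
  have h0 : ∫ s in a..b, (s - (a + b) / 2) * K ((a + b) / 2) = 0 := by
    rw [intervalIntegral.integral_mul_const, intervalIntegral.integral_sub (by simp) (by simp)]
    simp
    left; ring
  rw [← h0]
  apply intervalIntegral.integral_mono_on hab
  · exact ContinuousOn.intervalIntegrable_of_Icc hab (by fun_prop)
  · exact ContinuousOn.intervalIntegrable_of_Icc hab (by fun_prop)
  · intro s hs
    have hs' : s < c := lt_of_le_of_lt hs.2 hb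
    have hm' : (a + b) / 2 < c := by linarith
    rcases le_total s ((a + b) / 2) with h | h
    · have := hK.monotoneOn hs' hm' h
      nlinarith
    · have := hK.monotoneOn hm' hs' h
      nlinarith

/-- The first moment about the midpoint is at most the slope to the right times `(b - a)³ / 12`. -/
lemma moment_le (hK : IsConvexKernel K c) (hab : a ≤ b) {d : ℝ} (hbd : b < d) (hd : d < c) :
    ∫ s in a..b, (s - (a + b) / 2) * K s ≤ (K d - K b) / (d - b) * ((b - a) ^ 3 / 12) := by
  have hb : b < c := hbd.trans hd
  have hc := hK.continuousOn_Icc (a := a) hb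
  set σ := (K d - K b) / (d - b) with hσ
  -- By convexity, the secant slope over `[b, d]` bounds every secant slope to the left of `b`.
  have hslope : ∀ s s', s ≤ s' → s' ≤ b → K s' - K s ≤ σ * (s' - s) := by
    intro s s' hss hs'
    rcases hss.eq_or_lt with rfl | hlt
    · simp
    have h1 : (K s' - K s) / (s' - s) ≤ σ := by
      rcases hs'.eq_or_lt with rfl | hlt'
      · exact hK.convexOn.slope_mono_adjacent (hlt.trans hb) hd hlt hbd
      · exact (hK.convexOn.slope_mono_adjacent (hlt.trans (hlt'.trans hb)) hb hlt hlt').trans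
          (hK.convexOn.slope_mono_adjacent (hlt'.trans hb) hd hlt' hbd)
    rwa [div_le_iff₀ (by linarith)] at h1
  have h0 : ∫ s in a..b, ((s - (a + b) / 2) * K ((a + b) / 2) + σ * (s - (a + b) / 2) ^ 2)
      = σ * ((b - a) ^ 3 / 12) := by
    have h2 : ∫ s in a..b, (s - (a + b) / 2) ^ 2 = (b - a) ^ 3 / 12 := by
      rw [intervalIntegral.integral_comp_sub_right (fun x => x ^ 2), integral_pow]
      norm_num
      ring
    rw [intervalIntegral.integral_add (Continuous.intervalIntegrable (by fun_prop) _ _)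
      (Continuous.intervalIntegrable (by fun_prop) _ _), intervalIntegral.integral_const_mul, h2,
      intervalIntegral.integral_mul_const, intervalIntegral.integral_sub (by simp) (by simp)]
    simp
    left; ring
  rw [← h0]
  apply intervalIntegral.integral_mono_on hab
  · exact ContinuousOn.intervalIntegrable_of_Icc hab (by fun_prop)
  · exact ContinuousOn.intervalIntegrable_of_Icc hab (by fun_prop)
  · intro s hs
    rcases le_total s ((a + b) / 2) with h | h
    · have := hslope _ _ h (by linarith)
      nlinarith
    · have := hslope _ _ h hs.2
      nlinarith

/-- Upper chord bound for the integral of a convex function. -/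
lemma integral_le_trapezoid (hK : IsConvexKernel K c) (hab : a < b) (hb : b < c) :
    ∫ s in a..b, K s ≤ (b - a) * ((K a + K b) / 2) := by
  have hc := hK.continuousOn_Icc (a := a) hb
  set σ := (K b - K a) / (b - a) with hσ
  have hσ' : σ * (b - a) = K b - K a := div_mul_cancel₀ _ (by linarith)
  have h0 : ∫ s in a..b, (K a + σ * (s - a)) = (b - a) * ((K a + K b) / 2) := by
    rw [intervalIntegral.integral_add (by simp) (Continuous.intervalIntegrable (by fun_prop) _ _),
      intervalIntegral.integral_const_mul, intervalIntegral.integral_sub (by simp) (by simp)]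
    simp
    linear_combination (b - a) / 2 * hσ'
  rw [← h0]
  apply intervalIntegral.integral_mono_on hab.le
  · exact ContinuousOn.intervalIntegrable_of_Icc hab.le (by fun_prop)
  · exact ContinuousOn.intervalIntegrable_of_Icc hab.le (by fun_prop)
  · intro s hs
    rcases hs.1.eq_or_lt with rfl | h
    · simp
    rcases hs.2.eq_or_lt with rfl | h'
    · linarith
    have := hK.convexOn.slope_mono_adjacent (hab.trans hb) hb h h'
    have h3 : (K s - K a) * (b - s) ≤ (K b - K s) * (s - a) := by
      rwa [div_le_div_iff₀ (by linarith) (by linarith)] at this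
    have h4 : (K s - K a) * (b - a) ≤ σ * (s - a) * (b - a) := by
      have : σ * (s - a) * (b - a) = (K b - K a) * (s - a) := by rw [← hσ']; ring
      rw [this]; linarith
    linarith [le_of_mul_le_mul_right h4 (by linarith)]

/-- A weighted mean with a nonnegative affine weight lies between the endpoint values. -/
lemma weighted_mean_mem_Icc (hK : IsConvexKernel K c) (hab : a < b) (hb : b < c) {y : ℝ}
    (hy : 0 < y) :
    1 / (b - a) * (∫ s in a..b, K s) -
      2 / ((b - a) * ((b - a) + y)) * (∫ s in a..b, (s - (a + b) / 2) * K s) ∈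
      Set.Icc (K a) (K b) := by
  have hc := hK.continuousOn_Icc (a := a) hb
  have hba : 0 < b - a := sub_pos.2 hab
  set ψ : ℝ → ℝ := fun s => 1 / (b - a) - 2 / ((b - a) * ((b - a) + y)) * (s - (a + b) / 2)
    with hψ
  -- The affine weight has total mass one and decreases; at `s = b` its numerator is still `y > 0`.
  have hψ0 : ∀ s ∈ Set.Icc a b, 0 ≤ ψ s := by
    intro s hs
    have : ψ s = (b - a + y - 2 * (s - (a + b) / 2)) / ((b - a) * ((b - a) + y)) := by
      simp only [hψ]; field_simp
    rw [this]
    apply div_nonneg _ (by positivity)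
    linarith [hs.2]
  have hψc : Continuous ψ := by fun_prop
  have hψ1 : ∀ C : ℝ, ∫ s in a..b, ψ s * C = C := by
    intro C
    rw [intervalIntegral.integral_mul_const, intervalIntegral.integral_sub (by simp)
      (Continuous.intervalIntegrable (by fun_prop) _ _), intervalIntegral.integral_const_mul,
      intervalIntegral.integral_sub (by simp) (by simp)]
    simp
    field_simp
    ring
  have hrepr : 1 / (b - a) * (∫ s in a..b, K s) -
      2 / ((b - a) * ((b - a) + y)) * (∫ s in a..b, (s - (a + b) / 2) * K s) =
      ∫ s in a..b, ψ s * K s := by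
    rw [← intervalIntegral.integral_const_mul, ← intervalIntegral.integral_const_mul,
      ← intervalIntegral.integral_sub]
    · congr 1; ext s; simp only [hψ]; ring
    · exact ContinuousOn.intervalIntegrable_of_Icc hab.le (by fun_prop)
    · exact ContinuousOn.intervalIntegrable_of_Icc hab.le (by fun_prop)
  rw [hrepr]
  constructor
  · conv_lhs => rw [← hψ1 (K a)]
    apply intervalIntegral.integral_mono_on hab.le
    · exact ContinuousOn.intervalIntegrable_of_Icc hab.le (by fun_prop)
    · exact ContinuousOn.intervalIntegrable_of_Icc hab.le (by fun_prop)
    · intro s hs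
      exact mul_le_mul_of_nonneg_left
        (hK.monotoneOn (hab.trans hb) (lt_of_le_of_lt hs.2 hb) hs.1) (hψ0 s hs)
  · conv_rhs => rw [← hψ1 (K b)]
    apply intervalIntegral.integral_mono_on hab.le
    · exact ContinuousOn.intervalIntegrable_of_Icc hab.le (by fun_prop)
    · exact ContinuousOn.intervalIntegrable_of_Icc hab.le (by fun_prop)
    · intro s hs
      exact mul_le_mul_of_nonneg_left
        (hK.monotoneOn (lt_of_le_of_lt hs.2 hb) hb hs.2) (hψ0 s hs)

end IsConvexKernel

/-- Differences of shifted negative powers are convex kernels. -/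
lemma isConvexKernel_rpow_sub {α c d l : ℝ} (hα : 0 < α) (hcd : c ≤ d) (hl₁ : l ≤ 1) :
    IsConvexKernel (fun s => (c - s) ^ (-α) - l * (d - s) ^ (-α)) c := by
  have key : ∀ γ : ℝ, 0 < γ → ∀ s < c, 0 ≤ (c - s) ^ (-γ) - l * (d - s) ^ (-γ) := by
    intro γ hγ s hs
    have h1 : (d - s) ^ (-γ) ≤ (c - s) ^ (-γ) :=
      Real.rpow_le_rpow_of_nonpos (by linarith) (by linarith) (by linarith)
    have h2 : 0 ≤ (d - s) ^ (-γ) := Real.rpow_nonneg (by linarith) _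
    nlinarith
  -- The family is stable under differentiation, with `γ` replaced by `γ + 1`, so `key` gives the
  -- sign of the first two derivatives as well.
  have hder : ∀ γ : ℝ, ∀ s < c, HasDerivAt (fun s => (c - s) ^ (-γ) - l * (d - s) ^ (-γ))
      (γ * ((c - s) ^ (-(γ + 1)) - l * (d - s) ^ (-(γ + 1)))) s := by
    intro γ s hs
    have h1 := ((hasDerivAt_id s).const_sub c).rpow_const (p := -γ)
      (Or.inl (by simp; linarith))
    have h2 := ((hasDerivAt_id s).const_sub d).rpow_const (p := -γ)
      (Or.inl (by simp; linarith))
    refine (h1.sub (h2.const_mul l)).congr_deriv ?_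
    simp only [id]
    rw [show -γ - 1 = -(γ + 1) by ring]
    ring
  have hcont : ContinuousOn (fun s => (c - s) ^ (-α) - l * (d - s) ^ (-α)) (Set.Iio c) :=
    fun s hs => (hder α s hs).continuousAt.continuousWithinAt
  refine ⟨key α hα, ?_, ?_⟩
  · refine monotoneOn_of_hasDerivWithinAt_nonneg (convex_Iio c) hcont
      (f' := fun s => α * ((c - s) ^ (-(α + 1)) - l * (d - s) ^ (-(α + 1)))) ?_ ?_
    · intro s hs
      rw [interior_Iio] at hs
      exact (hder α s hs).hasDerivWithinAt
    · intro s hs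
      rw [interior_Iio] at hs
      exact mul_nonneg hα.le (key _ (by linarith) s hs)
  · refine convexOn_of_hasDerivWithinAt2_nonneg (convex_Iio c) hcont
      (f' := fun s => α * ((c - s) ^ (-(α + 1)) - l * (d - s) ^ (-(α + 1))))
      (f'' := fun s => α * ((α + 1) *
        ((c - s) ^ (-(α + 1 + 1)) - l * (d - s) ^ (-(α + 1 + 1))))) ?_ ?_ ?_
    · intro s hs
      rw [interior_Iio] at hs
      exact (hder α s hs).hasDerivWithinAt
    · intro s hs
      rw [interior_Iio] at hs
      exact ((hder (α + 1) s hs).const_mul α).hasDerivWithinAt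
    · intro s hs
      rw [interior_Iio] at hs
      exact mul_nonneg hα.le (mul_nonneg (by linarith) (key _ (by linarith) s hs))

lemma IsConvexKernel.div_const {K : ℝ → ℝ} {c G : ℝ} (hK : IsConvexKernel K c) (hG : 0 < G) :
    IsConvexKernel (fun s => K s / G) c := by
  refine ⟨fun s hs => div_nonneg (hK.nonneg s hs) hG.le, fun x hx y hy hxy => ?_, ?_⟩
  · exact div_le_div_of_nonneg_right (hK.monotoneOn hx hy hxy) hG.le
  · have := hK.convexOn.smul (c := G⁻¹) (by positivity)
    refine this.congr fun x _ => ?_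
    simp [div_eq_inv_mul]

/-! ### Positivity of lower triangular quadratic forms. -/

/-- A lower triangular kernel whose rows increase, whose row increments decrease from row to row,
and whose diagonal is large enough, is positive semidefinite. -/
lemma sum_lower_triangular_nonneg (B : ℕ → ℕ → ℝ) (N : ℕ) (hB0 : ∀ n, B n 0 = 0)
    (hrow : ∀ n k, n < N → k ≤ n → B (n + 1) k ≤ B (n + 1) (k + 1))
    (hmix : ∀ n k, n + 1 < N → k < n →
      B (n + 2) (k + 1) - B (n + 2) k ≤ B (n + 1) (k + 1) - B (n + 1) k)
    (hdiag : ∀ n, n + 1 < N →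
      B (n + 2) (n + 1) - B (n + 2) n ≤ 2 * B (n + 1) (n + 1) - B (n + 1) n)
    (v : ℕ → ℝ) :
    0 ≤ ∑ n ∈ Finset.range N, v n * ∑ k ∈ Finset.range (n + 1), B (n + 1) (k + 1) * v k := by
  set S : ℕ → ℕ → ℝ := fun k n => ∑ j ∈ Finset.Ico k n, v j with hS
  set d : ℕ → ℕ → ℝ := fun n k => B n (k + 1) - B n k with hd
  -- Abel summation: rewrite the row in terms of the tail sums `S`, with row increments `d` as
  -- coefficients.
  have abel : ∀ n m, m ≤ n → ∑ k ∈ Finset.range m, B (n + 1) (k + 1) * v k =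
      (∑ k ∈ Finset.range m, d (n + 1) k * S k (n + 1)) - B (n + 1) m * S m (n + 1) := by
    intro n m
    induction m with
    | zero => intro _; simp [hB0]
    | succ m ih =>
      intro hm
      rw [Finset.sum_range_succ, Finset.sum_range_succ, ih (by omega)]
      have : S m (n + 1) = v m + S (m + 1) (n + 1) :=
        Finset.sum_eq_sum_Ico_succ_bot (by omega) _
      simp only [hd, this]
      ring
  have abel' : ∀ n, ∑ k ∈ Finset.range (n + 1), B (n + 1) (k + 1) * v k =
      ∑ k ∈ Finset.range (n + 1), d (n + 1) k * S k (n + 1) := by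
    intro n
    rw [Finset.sum_range_succ, Finset.sum_range_succ, abel n n le_rfl]
    have : S n (n + 1) = v n := by simp [hS]
    simp only [hd, this]
    ring
  -- With `S k (n + 1) = S k n + v n`, use `2 v S' = S' ^ 2 - S ^ 2 + v ^ 2`; the increments `d`
  -- telescope to the diagonal entry in front of `v n ^ 2`.
  have hsplit : ∀ n, 2 * (v n * ∑ k ∈ Finset.range (n + 1), B (n + 1) (k + 1) * v k) =
      (∑ k ∈ Finset.range (n + 1), d (n + 1) k * S k (n + 1) ^ 2 + B (n + 1) (n + 1) * v n ^ 2)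
      - ∑ k ∈ Finset.range n, d (n + 1) k * S k n ^ 2 := by
    intro n
    have hSnn : S n n = 0 := by simp [hS]
    have htel : B (n + 1) (n + 1) = ∑ k ∈ Finset.range (n + 1), d (n + 1) k := by
      simp only [hd]
      rw [Finset.sum_range_sub, hB0, sub_zero]
    have hlast : ∑ k ∈ Finset.range n, d (n + 1) k * S k n ^ 2 =
        ∑ k ∈ Finset.range (n + 1), d (n + 1) k * S k n ^ 2 := by
      rw [Finset.sum_range_succ, hSnn]; simp
    rw [abel', hlast, htel, Finset.mul_sum, Finset.mul_sum, Finset.sum_mul,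
      ← Finset.sum_add_distrib, ← Finset.sum_sub_distrib]
    refine Finset.sum_congr rfl fun k hk => ?_
    have : S k (n + 1) = S k n + v n :=
      Finset.sum_Ico_succ_top (by simpa [Nat.lt_succ_iff] using hk) _
    rw [this]; ring
  have hmain : ∀ n, n < N →
      (∑ k ∈ Finset.range (n + 1), d (n + 1) k * S k (n + 1) ^ 2 + B (n + 1) (n + 1) * v n ^ 2) ≤
      2 * ∑ n ∈ Finset.range (n + 1), v n * ∑ k ∈ Finset.range (n + 1), B (n + 1) (k + 1) * v k := by
    intro n
    induction n with
    | zero =>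
      intro _
      have := hsplit 0
      simp only [Finset.range_zero, Finset.sum_empty, sub_zero] at this
      rw [Finset.sum_range_one (fun n => v n * _), this]
    | succ n ih =>
      intro hn
      rw [Finset.sum_range_succ (fun n => v n * _) (n + 1), mul_add, hsplit (n + 1)]
      have h1 := ih (by omega)
      -- The negative part of the new row is absorbed by the form of the old one: `hmix` handles `k
      -- < n`. For `k = n` the tail sum is `v n`, and the two old terms in `v n ^ 2` have
      -- coefficient `2 B (n + 1) (n + 1) - B (n + 1) n`, whence `hdiag`.
      have h2 : ∑ k ∈ Finset.range (n + 1), d (n + 2) k * S k (n + 1) ^ 2 ≤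
          ∑ k ∈ Finset.range (n + 1), d (n + 1) k * S k (n + 1) ^ 2 +
            B (n + 1) (n + 1) * v n ^ 2 := by
        rw [Finset.sum_range_succ, Finset.sum_range_succ, add_assoc]
        refine add_le_add (Finset.sum_le_sum fun k hk => ?_) ?_
        · exact mul_le_mul_of_nonneg_right (hmix n k hn (Finset.mem_range.1 hk)) (sq_nonneg _)
        · have : S n (n + 1) = v n := by simp [hS]
          rw [this, ← add_mul]
          refine mul_le_mul_of_nonneg_right ?_ (sq_nonneg _)
          have := hdiag n hn
          simp only [hd]
          linarith
      linarith
  rcases Nat.eq_zero_or_pos N with rfl | hN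
  · simp
  obtain ⟨n, rfl⟩ : ∃ n, N = n + 1 := ⟨N - 1, by omega⟩
  have h1 := hmain n (by omega)
  have hmono : ∀ k, k ≤ n + 1 → 0 ≤ B (n + 1) k := by
    intro k
    induction k with
    | zero => intro _; rw [hB0]
    | succ k ih => intro hk; exact (ih (by omega)).trans (hrow n k (by omega) (by omega))
  have h2 : 0 ≤ ∑ k ∈ Finset.range (n + 1), d (n + 1) k * S k (n + 1) ^ 2 :=
    Finset.sum_nonneg fun k hk => mul_nonneg
      (sub_nonneg.2 (hrow n k (by omega) (by have := Finset.mem_range.1 hk; omega))) (sq_nonneg _)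
  have h3 : 0 ≤ B (n + 1) (n + 1) * v n ^ 2 := mul_nonneg (hmono _ le_rfl) (sq_nonneg _)
  linarith

/-! ### Kernel entries as functionals of a convex function on the time mesh. -/

noncomputable section

/-- The mean of `K` over the `k`-th time interval. -/
def mean (t : ℕ → ℝ) (K : ℝ → ℝ) (k : ℕ) : ℝ :=
  1 / step t k * ∫ s in (t (k - 1))..(t k), K s

/-- The scaled first moment of `K` about the midpoint of the `k`-th time interval. -/
def moment (t : ℕ → ℝ) (K : ℝ → ℝ) (k : ℕ) : ℝ :=
  2 / (step t k * (step t k + step t (k + 1))) *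
    ∫ s in (t (k - 1))..(t k), (s - offsetTime (1 / 2) t k) * K s

/-- The off-diagonal kernel entry in column `k` generated by `K`. -/
def kernelRow (t : ℕ → ℝ) (K : ℝ → ℝ) (k : ℕ) : ℝ :=
  mean t K k + moment t K (k - 1) / ratio t k - moment t K k

/-- The weakly singular kernel of the `n`-th off-set time level. -/
def offsetKernel (α : ℝ) (t : ℕ → ℝ) (n : ℕ) (s : ℝ) : ℝ :=
  omegaKernel (1 - α) (offsetTime (α / 2) t n - s)

/-- Truncated subtraction makes `step t 0 = 0`. Thus `kernelRow` also covers the first column, which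
has no contribution from the left, and vanishes in column zero. -/
lemma moment_zero (t : ℕ → ℝ) (K : ℝ → ℝ) : moment t K 0 = 0 := by simp [moment]

lemma kernelRow_zero (t : ℕ → ℝ) (K : ℝ → ℝ) : kernelRow t K 0 = 0 := by
  simp [kernelRow, moment_zero, mean]

namespace IsTimeMesh

variable {N : ℕ} {t : ℕ → ℝ}

lemma step_pos (ht : IsTimeMesh N t) {k : ℕ} (h1 : 1 ≤ k) (hk : k ≤ N) : 0 < step t k :=
  sub_pos.2 (ht.2 k h1 hk)

lemma pred_le (ht : IsTimeMesh N t) {k : ℕ} (hk : k ≤ N) : t (k - 1) ≤ t k := by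
  rcases Nat.eq_zero_or_pos k with rfl | h
  · simp
  · exact (ht.2 k h hk).le

lemma le (ht : IsTimeMesh N t) {j k : ℕ} (hjk : j ≤ k) (hk : k ≤ N) : t j ≤ t k := by
  induction k, hjk using Nat.le_induction with
  | base => exact le_rfl
  | succ k hjk ih => exact (ih (by omega)).trans (by simpa using ht.pred_le hk)

lemma lt_offsetTime (ht : IsTimeMesh N t) {k n : ℕ} (hkn : k < n) (hn : n ≤ N) {σ : ℝ}
    (hσ : σ < 1) : t k < offsetTime σ t n := by
  have h1 := ht.le (show k ≤ n - 1 by omega) (by omega)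
  have h2 := ht.2 n (by omega) hn
  have : 0 < (1 - σ) * (t n - t (n - 1)) := mul_pos (by linarith) (by linarith)
  simp only [offsetTime]
  linarith

lemma ratio_nonneg (ht : IsTimeMesh N t) {k : ℕ} (hk : k ≤ N) : 0 ≤ ratio t k :=
  div_nonneg (sub_nonneg.2 (ht.pred_le hk)) (sub_nonneg.2 (ht.pred_le (by omega)))

end IsTimeMesh

lemma offsetTime_half (t : ℕ → ℝ) (k : ℕ) : offsetTime (1 / 2) t k = (t (k - 1) + t k) / 2 := by
  simp only [offsetTime]; ring

section estimates

variable {N : ℕ} {t : ℕ → ℝ} {K : ℝ → ℝ} {c : ℝ}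

lemma moment_nonneg (ht : IsTimeMesh N t) (hK : IsConvexKernel K c) {k : ℕ} (hk : k < N)
    (hc : t k < c) : 0 ≤ moment t K k := by
  have h1 : 0 ≤ step t k := sub_nonneg.2 (ht.pred_le hk.le)
  have h2 : 0 ≤ step t (k + 1) := sub_nonneg.2 (ht.pred_le hk)
  refine mul_nonneg (by positivity) ?_
  rw [offsetTime_half]
  exact hK.moment_nonneg (ht.pred_le hk.le) hc

lemma mean_sub_moment_mem_Icc (ht : IsTimeMesh N t) (hK : IsConvexKernel K c) {k : ℕ}
    (h1 : 1 ≤ k) (hk : k < N) (hc : t k < c) :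
    mean t K k - moment t K k ∈ Set.Icc (K (t (k - 1))) (K (t k)) := by
  have := hK.weighted_mean_mem_Icc (ht.2 k h1 hk.le) hc
    (ht.step_pos (show 1 ≤ k + 1 by omega) hk)
  rw [mean, moment, offsetTime_half]
  exact this

/-- The part of the `k`-th column coming from the past is dominated by the endpoint value. -/
lemma mean_add_moment_le (ht : IsTimeMesh N t)
    (hratio : ∀ k, 2 ≤ k → k ≤ N → 4 / 7 ≤ ratio t k) (hK : IsConvexKernel K c) {k : ℕ}
    (hk : k < N) (hc : t k < c) :
    mean t K k + moment t K (k - 1) / ratio t k ≤ K (t k) := by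
  rcases Nat.eq_zero_or_pos k with rfl | h1
  · simpa [mean, moment_zero] using hK.nonneg _ hc
  have hx := ht.step_pos h1 hk.le
  have hlt := ht.2 k h1 hk.le
  have htrap := hK.integral_le_trapezoid hlt hc
  set σ := (K (t k) - K (t (k - 1))) / (t k - t (k - 1)) with hσ
  have hσx : σ * step t k = K (t k) - K (t (k - 1)) :=
    div_mul_cancel₀ _ (by linarith)
  have hσ0 : 0 ≤ σ := div_nonneg
    (sub_nonneg.2 (hK.monotoneOn (hlt.trans hc) hc hlt.le)) (by linarith)
  -- The trapezoid bound leaves a gap `σ * step t k / 2` below the endpoint value, which has to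
  -- accommodate the moment of the previous interval.
  have hmean : mean t K k ≤ K (t k) - σ * step t k / 2 := by
    rw [mean, one_div, inv_mul_le_iff₀ hx, hσx]
    refine htrap.trans (le_of_eq ?_)
    simp only [step]
    ring
  suffices h : moment t K (k - 1) / ratio t k ≤ σ * step t k / 2 by linarith
  rcases eq_or_lt_of_le (show 1 ≤ k from h1) with rfl | h2
  · simp only [Nat.sub_self, moment_zero, zero_div]
    positivity
  have hz := ht.step_pos (show 1 ≤ k - 1 by omega) (by omega)
  have hmom := hK.moment_le (ht.2 (k - 1) (by omega) (by omega)).le hlt hc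
  rw [← hσ, ← offsetTime_half] at hmom
  have hr := hratio k h2 hk.le
  rw [ratio, le_div_iff₀ hz] at hr
  rw [moment, ratio, Nat.sub_add_cancel h1]
  change _ ≤ σ * (step t (k - 1) ^ 3 / 12) at hmom
  set z := step t (k - 1)
  set x := step t k
  calc _ ≤ 2 / (z * (z + x)) * (σ * (z ^ 3 / 12)) / (x / z) := by gcongr
    _ = σ * (z ^ 3 / (6 * (z + x) * x)) := by field_simp; ring
    _ ≤ σ * (x / 2) := by
      refine mul_le_mul_of_nonneg_left ?_ hσ0
      rw [div_le_div_iff₀ (by positivity) (by norm_num)]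
      -- The claim is `z ^ 3 ≤ 3 * x ^ 2 * (z + x)`. The ratio bound gives `z ^ 3 ≤ 49 / 16 * x ^ 2
      -- * z`, and the excess `x ^ 2 * z / 16` is below `3 * x ^ 3`.
      have h1 : z ≤ 7 / 4 * x := by linarith
      have h2 : z ^ 2 ≤ (7 / 4 * x) ^ 2 := by gcongr
      have h3 : z ^ 3 ≤ (7 / 4 * x) ^ 2 * z := by
        rw [pow_succ]; gcongr
      nlinarith [mul_pos hx hz, mul_pos (mul_pos hx hx) hz, mul_pos (mul_pos hx hx) hx]
    _ = σ * x / 2 := by ring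

lemma kernelRow_le (ht : IsTimeMesh N t)
    (hratio : ∀ k, 2 ≤ k → k ≤ N → 4 / 7 ≤ ratio t k) (hK : IsConvexKernel K c) {k : ℕ}
    (hk : k < N) (hc : t k < c) : kernelRow t K k ≤ K (t k) := by
  have h1 := mean_add_moment_le ht hratio hK hk hc
  have h2 := moment_nonneg ht hK hk hc
  rw [kernelRow]
  linarith

/-- The value `K (t k)` separates the two entries: it bounds column `k` from above, and bounds `mean
- moment` of column `k + 1` from below. -/
lemma kernelRow_le_succ (ht : IsTimeMesh N t)
    (hratio : ∀ k, 2 ≤ k → k ≤ N → 4 / 7 ≤ ratio t k) (hK : IsConvexKernel K c) {k : ℕ}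
    (hk : k + 1 < N) (hc : t (k + 1) < c) : kernelRow t K k ≤ kernelRow t K (k + 1) := by
  have hc' : t k < c := lt_of_le_of_lt (ht.le (Nat.le_succ k) hk.le) hc
  have h1 := kernelRow_le ht hratio hK (by omega) hc'
  have h2 := (mean_sub_moment_mem_Icc ht hK (by omega) hk hc).1
  have h3 := div_nonneg (moment_nonneg ht hK (show k < N by omega) hc')
    (ht.ratio_nonneg hk.le)
  have h4 : kernelRow t K (k + 1) =
      mean t K (k + 1) + moment t K k / ratio t (k + 1) - moment t K (k + 1) := rfl
  rw [Nat.add_sub_cancel] at h2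
  linarith

lemma kernelRow_nonneg (ht : IsTimeMesh N t) (hK : IsConvexKernel K c) {k : ℕ}
    (hk : k < N) (hc : t k < c) : 0 ≤ kernelRow t K k := by
  rcases Nat.eq_zero_or_pos k with rfl | h1
  · rw [kernelRow_zero]
  have hc' : t (k - 1) < c := (ht.2 k h1 hk.le).trans hc
  have h2 := (mean_sub_moment_mem_Icc ht hK h1 hk hc).1
  have h3 := div_nonneg (moment_nonneg ht hK (show k - 1 < N by omega) hc')
    (ht.ratio_nonneg hk.le)
  have h4 := hK.nonneg _ hc'
  rw [kernelRow]
  linarith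

lemma mean_sub (ht : IsTimeMesh N t) {K₁ K₂ : ℝ → ℝ} {c₁ c₂ : ℝ} (h₁ : IsConvexKernel K₁ c₁)
    (h₂ : IsConvexKernel K₂ c₂) {k : ℕ} (hk : k ≤ N) (hc₁ : t k < c₁) (hc₂ : t k < c₂) :
    mean t (fun s => K₁ s - K₂ s) k = mean t K₁ k - mean t K₂ k := by
  have i₁ := h₁.continuousOn_Icc (a := t (k - 1)) hc₁
  have i₂ := h₂.continuousOn_Icc (a := t (k - 1)) hc₂
  rw [mean, mean, mean, intervalIntegral.integral_sub, mul_sub]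
  · exact i₁.intervalIntegrable_of_Icc (ht.pred_le hk)
  · exact i₂.intervalIntegrable_of_Icc (ht.pred_le hk)

lemma moment_sub (ht : IsTimeMesh N t) {K₁ K₂ : ℝ → ℝ} {c₁ c₂ : ℝ} (h₁ : IsConvexKernel K₁ c₁)
    (h₂ : IsConvexKernel K₂ c₂) {k : ℕ} (hk : k ≤ N) (hc₁ : t k < c₁) (hc₂ : t k < c₂) :
    moment t (fun s => K₁ s - K₂ s) k = moment t K₁ k - moment t K₂ k := by
  have i₁ := h₁.continuousOn_Icc (a := t (k - 1)) hc₁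
  have i₂ := h₂.continuousOn_Icc (a := t (k - 1)) hc₂
  simp only [moment, mul_sub (_ - offsetTime _ _ _)]
  rw [intervalIntegral.integral_sub, mul_sub]
  · exact ContinuousOn.intervalIntegrable_of_Icc (ht.pred_le hk) (by fun_prop)
  · exact ContinuousOn.intervalIntegrable_of_Icc (ht.pred_le hk) (by fun_prop)

/-- Linearity turns a comparison of two rows into monotonicity of the single row generated by the
difference of their kernels. -/
lemma kernelRow_sub (ht : IsTimeMesh N t) {K₁ K₂ : ℝ → ℝ} {c₁ c₂ : ℝ}
    (h₁ : IsConvexKernel K₁ c₁) (h₂ : IsConvexKernel K₂ c₂) {k : ℕ} (hk : k ≤ N)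
    (hc₁ : t k < c₁) (hc₂ : t k < c₂) :
    kernelRow t (fun s => K₁ s - K₂ s) k = kernelRow t K₁ k - kernelRow t K₂ k := by
  have hle := ht.pred_le hk
  rw [kernelRow, mean_sub ht h₁ h₂ hk hc₁ hc₂, moment_sub ht h₁ h₂ hk hc₁ hc₂,
    moment_sub ht h₁ h₂ (show k - 1 ≤ N by omega) (by linarith) (by linarith), kernelRow, kernelRow]
  ring

end estimates

/-! ### The L2-1σ kernels and their positive semidefiniteness. -/

section kernels

variable {α : ℝ} {N : ℕ} {t : ℕ → ℝ}

lemma offsetKernel_eq (α : ℝ) (t : ℕ → ℝ) (n : ℕ) (s : ℝ) :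
    offsetKernel α t n s = (offsetTime (α / 2) t n - s) ^ (-α) / Real.Gamma (1 - α) := by
  rw [offsetKernel, omegaKernel]
  congr 2; ring

lemma isConvexKernel_offsetKernel (hα₀ : 0 < α) (hα₁ : α < 1) (t : ℕ → ℝ) (n : ℕ) :
    IsConvexKernel (offsetKernel α t n) (offsetTime (α / 2) t n) := by
  have := (isConvexKernel_rpow_sub (l := 0) hα₀ (le_refl (offsetTime (α / 2) t n))
    zero_le_one).div_const (Real.Gamma_pos_of_pos (show 0 < 1 - α by linarith))
  convert this using 2 with s
  rw [offsetKernel_eq]; ring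

lemma offsetTime_le_succ (ht : IsTimeMesh N t) {σ : ℝ} (h0 : 0 ≤ σ) (h1 : σ < 1) {n : ℕ}
    (hn : n < N) : offsetTime σ t n ≤ offsetTime σ t (n + 1) := by
  have h2 := ht.pred_le hn.le
  have h3 := ht.lt_offsetTime (Nat.lt_succ_self n) hn h1
  have : offsetTime σ t n ≤ t n := by simp only [offsetTime]; nlinarith
  exact this.trans h3.le

lemma isConvexKernel_offsetKernel_sub (ht : IsTimeMesh N t) (hα₀ : 0 < α) (hα₁ : α < 1) {n : ℕ}
    (hn : n < N) :
    IsConvexKernel (fun s => offsetKernel α t n s - offsetKernel α t (n + 1) s)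
      (offsetTime (α / 2) t n) := by
  have := (isConvexKernel_rpow_sub (l := 1) hα₀
    (offsetTime_le_succ ht (σ := α / 2) (by linarith) (by linarith) hn)
    le_rfl).div_const (Real.Gamma_pos_of_pos (show 0 < 1 - α by linarith))
  convert this using 2 with s
  rw [offsetKernel_eq, offsetKernel_eq]; ring

lemma coeffA_eq_mean (ht : IsTimeMesh N t) (hα₁ : α < 1) {n k : ℕ} (hkn : k < n) (hn : n ≤ N) :
    coeffA α t n k = mean t (offsetKernel α t n) k := by
  rw [coeffA, min_eq_left (ht.lt_offsetTime hkn hn (by linarith)).le]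
  rfl

lemma coeffB_eq_moment (n k : ℕ) : coeffB α t n k = moment t (offsetKernel α t n) k := rfl

lemma kernelB_eq_kernelRow (ht : IsTimeMesh N t) (hα₁ : α < 1) {n k : ℕ} (h1 : 1 ≤ k)
    (hkn : k < n) (hn : n ≤ N) :
    kernelB α t n k = kernelRow t (offsetKernel α t n) k := by
  rw [kernelB, if_neg (by omega), if_neg (by omega), coeffA_eq_mean ht hα₁ hkn hn,
    coeffB_eq_moment, kernelRow]
  split_ifs with h
  · subst h
    rw [coeffA_eq_mean ht hα₁ hkn hn]
    simp [moment_zero]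
  · rfl

lemma offsetTime_sub_pred (σ : ℝ) (t : ℕ → ℝ) (n : ℕ) :
    offsetTime σ t n - t (n - 1) = (1 - σ) * step t n := by
  simp only [offsetTime, step]; ring

/-- The last integral stops at the off-set time, where the kernel is singular, so it is computed
exactly and then expressed through the kernel value at the left endpoint. -/
lemma coeffA_diag (ht : IsTimeMesh N t) (hα₀ : 0 < α) (hα₁ : α < 1) {n : ℕ} (h1 : 1 ≤ n)
    (hn : n ≤ N) :
    coeffA α t n n = (1 - α / 2) / (1 - α) * offsetKernel α t n (t (n - 1)) := by
  have hx := ht.step_pos h1 hn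
  have hmin : min (t n) (offsetTime (α / 2) t n) = offsetTime (α / 2) t n := by
    apply min_eq_right
    simp only [offsetTime]
    nlinarith [ht.pred_le hn]
  have hint : ∫ s in (t (n - 1))..(offsetTime (α / 2) t n),
      omegaKernel (1 - α) (offsetTime (α / 2) t n - s) =
      ((1 - α / 2) * step t n) ^ (1 - α) / (1 - α) / Real.Gamma (1 - α) := by
    rw [intervalIntegral.integral_comp_sub_left (fun x => omegaKernel (1 - α) x), sub_self,
      offsetTime_sub_pred]
    simp only [omegaKernel]
    rw [intervalIntegral.integral_div, integral_rpow (Or.inl (by linarith)),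
      sub_add_cancel, Real.zero_rpow (by linarith), sub_zero]
  rw [coeffA, hmin, hint, offsetKernel_eq, offsetTime_sub_pred]
  have hy : 0 < (1 - α / 2) * step t n := mul_pos (by linarith) hx
  rw [show 1 - α = -α + 1 by ring, Real.rpow_add_one hy.ne']
  field_simp

lemma kernelB_diag {n : ℕ} :
    kernelB α t n n = coeffA α t n n + moment t (offsetKernel α t n) (n - 1) / ratio t n := by
  rw [kernelB, if_pos rfl]
  split_ifs with h
  · subst h; simp [moment_zero]
  · rfl

/-- The next off-set kernel at the end of a step is controlled by the diagonal coefficient. -/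
lemma offsetKernel_succ_le (ht : IsTimeMesh N t) (hα₀ : 0 < α) (hα₁ : α < 1)
    (hratio : ∀ k, 2 ≤ k → k ≤ N → 4 / 7 ≤ ratio t k) {n : ℕ} (h1 : 1 ≤ n) (hn : n < N) :
    (1 - α) * offsetKernel α t (n + 1) (t n) ≤ offsetKernel α t n (t (n - 1)) := by
  have hG := Real.Gamma_pos_of_pos (show 0 < 1 - α by linarith)
  have hx := ht.step_pos h1 hn.le
  have hr := hratio (n + 1) (by omega) hn
  rw [ratio, Nat.add_sub_cancel, le_div_iff₀ hx] at hr
  have h2 := offsetTime_sub_pred (α / 2) t (n + 1)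
  rw [Nat.add_sub_cancel] at h2
  rw [offsetKernel_eq, offsetKernel_eq, h2, offsetTime_sub_pred, ← mul_div_assoc]
  refine div_le_div_of_nonneg_right ?_ hG.le
  have hq : 0 < 1 - α / 2 := by linarith
  have h3 : ((1 - α / 2) * step t (n + 1)) ^ (-α) ≤
      (4 / 7 * ((1 - α / 2) * step t n)) ^ (-α) := by
    refine Real.rpow_le_rpow_of_nonpos (mul_pos (by norm_num) (mul_pos hq hx)) ?_ (by linarith)
    nlinarith
  rw [Real.mul_rpow (by norm_num) (mul_pos hq hx).le] at h3
  -- Bernoulli's inequality for `(7 / 4) ^ α`; the product `(1 - α) * (1 + 3 / 4 * α)` is then at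
  -- most one.
  have h4 : ((4 : ℝ) / 7) ^ (-α) ≤ 1 + 3 / 4 * α := by
    rw [Real.rpow_neg (by norm_num), ← Real.inv_rpow (by norm_num)]
    have := rpow_one_add_le_one_add_mul_self (s := 3 / 4) (by norm_num) hα₀.le hα₁.le
    norm_num at this ⊢
    linarith
  have h5 : 0 ≤ ((1 - α / 2) * step t n) ^ (-α) :=
    Real.rpow_nonneg (mul_pos hq hx).le _
  calc (1 - α) * ((1 - α / 2) * step t (n + 1)) ^ (-α)
      ≤ (1 - α) * ((1 + 3 / 4 * α) * ((1 - α / 2) * step t n) ^ (-α)) := by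
        refine mul_le_mul_of_nonneg_left ?_ (by linarith)
        exact h3.trans (mul_le_mul_of_nonneg_right h4 h5)
    _ = ((1 - α) * (1 + 3 / 4 * α)) * ((1 - α / 2) * step t n) ^ (-α) := by ring
    _ ≤ 1 * ((1 - α / 2) * step t n) ^ (-α) :=
        mul_le_mul_of_nonneg_right (by nlinarith) h5
    _ = _ := one_mul _

/-- The L2-1σ kernels are positive semidefinite when the step ratios are at least `4 / 7`. -/
theorem sum_kernelB_nonneg (ht : IsTimeMesh N t) (hα₀ : 0 < α) (hα₁ : α < 1)
    (hratio : ∀ k, 2 ≤ k → k ≤ N → 4 / 7 ≤ ratio t k) (v : ℕ → ℝ) :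
    0 ≤ ∑ n ∈ Finset.range N, v n *
      ∑ k ∈ Finset.range (n + 1), kernelB α t (n + 1) (k + 1) * v k := by
  set B : ℕ → ℕ → ℝ := fun n k => if k = 0 then 0 else kernelB α t n k with hB
  have hσ : α / 2 < 1 := by linarith
  have hker := isConvexKernel_offsetKernel hα₀ hα₁ t
  have hBrow : ∀ n k, k < n → n ≤ N → B n k = kernelRow t (offsetKernel α t n) k := by
    intro n k hkn hn
    simp only [hB]
    split_ifs with h
    · rw [h, kernelRow_zero]
    · exact kernelB_eq_kernelRow ht hα₁ (by omega) hkn hn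
  have hBdiag : ∀ n, n < N → B (n + 1) (n + 1) =
      (1 - α / 2) / (1 - α) * offsetKernel α t (n + 1) (t n) +
        moment t (offsetKernel α t (n + 1)) n / ratio t (n + 1) := by
    intro n hn
    simp only [hB, Nat.add_one_ne_zero, if_false]
    rw [kernelB_diag, coeffA_diag ht hα₀ hα₁ (Nat.succ_pos n) hn]
    rfl
  have hlt : ∀ k n, k < n → n ≤ N → t k < offsetTime (α / 2) t n :=
    fun k n h hn => ht.lt_offsetTime h hn hσ
  have hw : ∀ n, n < N → 0 ≤ offsetKernel α t (n + 1) (t n) := fun n hn =>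
    (hker (n + 1)).nonneg _ (hlt n (n + 1) (Nat.lt_succ_self n) hn)
  have hprev : ∀ n, n < N → B (n + 1) n ≤ offsetKernel α t (n + 1) (t n) := by
    intro n hn
    rw [hBrow _ _ (Nat.lt_succ_self n) hn]
    exact kernelRow_le ht hratio (hker _) hn (hlt n (n + 1) (Nat.lt_succ_self n) hn)
  have hmom : ∀ n, n < N → 0 ≤ moment t (offsetKernel α t (n + 1)) n / ratio t (n + 1) :=
    fun n hn => div_nonneg (moment_nonneg ht (hker _) hn (hlt n (n + 1) (Nat.lt_succ_self n) hn))
      (ht.ratio_nonneg hn)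
  have hpos : 0 < 1 - α := by linarith
  refine sum_lower_triangular_nonneg B N (fun n => by simp [hB]) ?_ ?_ ?_ v
  · intro n k hn hk
    rcases hk.eq_or_lt with rfl | hk
    · have h1 : offsetKernel α t (k + 1) (t k) ≤
          (1 - α / 2) / (1 - α) * offsetKernel α t (k + 1) (t k) := by
        refine le_mul_of_one_le_left (hw k hn) ?_
        rw [one_le_div hpos]; linarith
      linarith [hBdiag k hn, hprev k hn, hmom k hn]
    · rw [hBrow _ _ (by omega) hn, hBrow _ _ (by omega) hn]
      exact kernelRow_le_succ ht hratio (hker _) (by omega) (hlt _ _ (by omega) hn)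
  -- Row increments decrease because the row generated by the difference of consecutive off-set
  -- kernels increases.
  · intro n k hn hk
    have hdiff := isConvexKernel_offsetKernel_sub ht hα₀ hα₁ hn
    have h1 := kernelRow_le_succ ht hratio hdiff (k := k) (by omega)
      (hlt _ _ (by omega) hn.le)
    rw [kernelRow_sub ht (hker _) (hker _) (by omega) (hlt _ _ (by omega) hn.le)
      (hlt _ _ (by omega) hn), kernelRow_sub ht (hker _) (hker _) (by omega)
      (hlt _ _ (by omega) hn.le) (hlt _ _ (by omega) hn)] at h1
    rw [hBrow _ _ (by omega) hn, hBrow _ _ (by omega) hn, hBrow _ _ (by omega) hn.le,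
      hBrow _ _ (by omega) hn.le]
    linarith
  · intro n hn
    have hdiff := isConvexKernel_offsetKernel_sub ht hα₀ hα₁ hn
    have hn' : n < N := by omega
    have h1 := moment_nonneg ht hdiff hn' (hlt n (n + 1) (by omega) hn')
    rw [moment_sub ht (hker _) (hker _) hn'.le (hlt _ _ (by omega) hn')
      (hlt _ _ (by omega) hn)] at h1
    have h2 : moment t (offsetKernel α t (n + 2)) n / ratio t (n + 1) ≤
        moment t (offsetKernel α t (n + 1)) n / ratio t (n + 1) :=
      div_le_div_of_nonneg_right (by linarith) (ht.ratio_nonneg hn')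
    have h3 : kernelRow t (offsetKernel α t (n + 2)) (n + 1) ≤
        offsetKernel α t (n + 2) (t (n + 1)) +
          moment t (offsetKernel α t (n + 2)) n / ratio t (n + 1) := by
      have := (mean_sub_moment_mem_Icc ht (hker (n + 2)) (show 1 ≤ n + 1 by omega) hn
        (hlt _ _ (by omega) hn)).2
      rw [kernelRow, Nat.add_sub_cancel]
      linarith
    have h4 : 0 ≤ kernelRow t (offsetKernel α t (n + 2)) n :=
      kernelRow_nonneg ht (hker _) hn' (hlt _ _ (by omega) hn)
    have h5 := offsetKernel_succ_le ht hα₀ hα₁ hratio (show 1 ≤ n + 1 by omega) hn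
    rw [Nat.add_sub_cancel] at h5
    have h6 : offsetKernel α t (n + 2) (t (n + 1)) ≤
        1 / (1 - α) * offsetKernel α t (n + 1) (t n) := by
      rw [one_div, le_inv_mul_iff₀ hpos]; exact h5
    -- The off-set `α / 2` gives `2 * (1 - α / 2) = 1 + (1 - α)`. The first summand absorbs the
    -- endpoint value of the next row (`h6`), the second absorbs the entry left of the diagonal
    -- (`hprev`).
    have h7 : 2 * ((1 - α / 2) / (1 - α) * offsetKernel α t (n + 1) (t n)) =
        1 / (1 - α) * offsetKernel α t (n + 1) (t n) + offsetKernel α t (n + 1) (t n) := by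
      field_simp; ring
    rw [hBrow _ _ (by omega) hn, hBrow _ _ (by omega) hn]
    linarith [hBdiag n hn', hprev n hn', hmom n hn']

end kernels

end

/-! ### Discrete inner products and summation by parts. -/

section grid

variable {M : ℕ} (L : ℝ)

lemma discreteGradX_weighted (s : ℝ) (a b : Grid M) :
    discreteGradX L (weighted s a b) =
      (1 - s) • discreteGradX L a + s • discreteGradX L b := by
  ext i j
  simp only [discreteGradX, weighted, Pi.add_apply, Pi.smul_apply, smul_eq_mul]
  ring

lemma discreteGradY_weighted (s : ℝ) (a b : Grid M) :
    discreteGradY L (weighted s a b) =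
      (1 - s) • discreteGradY L a + s • discreteGradY L b := by
  ext i j
  simp only [discreteGradY, weighted, Pi.add_apply, Pi.smul_apply, smul_eq_mul]
  ring

lemma discreteGradX_sub (a b : Grid M) :
    discreteGradX L (a - b) = discreteGradX L a - discreteGradX L b := by
  ext i j
  simp only [discreteGradX, Pi.sub_apply]
  ring

lemma discreteGradY_sub (a b : Grid M) :
    discreteGradY L (a - b) = discreteGradY L a - discreteGradY L b := by
  ext i j
  simp only [discreteGradY, Pi.sub_apply]
  ring

variable [NeZero M]

lemma gridInner_add_left (u v w : Grid M) :
    gridInner L (u + v) w = gridInner L u w + gridInner L v w := by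
  simp only [gridInner, Pi.add_apply, add_mul, Finset.sum_add_distrib, mul_add]

lemma gridInner_smul_left (a : ℝ) (v w : Grid M) :
    gridInner L (a • v) w = a * gridInner L v w := by
  simp only [gridInner, Pi.smul_apply, smul_eq_mul, mul_assoc, ← Finset.mul_sum]
  ring

lemma gridInner_comm (v w : Grid M) : gridInner L v w = gridInner L w v := by
  simp only [gridInner, mul_comm]

lemma gridInner_smul_right (a : ℝ) (v w : Grid M) :
    gridInner L v (a • w) = a * gridInner L v w := by
  rw [gridInner_comm, gridInner_smul_left, gridInner_comm]

lemma gridInner_sub_left (u v w : Grid M) :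
    gridInner L (u - v) w = gridInner L u w - gridInner L v w := by
  rw [sub_eq_add_neg, gridInner_add_left, ← neg_one_smul ℝ v, gridInner_smul_left]
  ring

lemma gridInner_self_nonneg (v : Grid M) : 0 ≤ gridInner L v v :=
  mul_nonneg (sq_nonneg _)
    (Finset.sum_nonneg fun _ _ => Finset.sum_nonneg fun _ _ => mul_self_nonneg _)

/-- Summation by parts on one periodic direction. -/
lemma sum_secondDiff_mul (a b : ZMod M → ℝ) :
    ∑ i, (a (i + 1) + a (i - 1) - 2 * a i) * b i =
      -∑ i, (a (i + 1) - a i) * (b (i + 1) - b i) := by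
  have h1 : ∑ i, a (i - 1) * b i = ∑ i, a i * b (i + 1) := by
    rw [← Equiv.sum_comp (Equiv.addRight (1 : ZMod M))]
    simp
  have h2 : ∑ i, a i * b i = ∑ i, a (i + 1) * b (i + 1) :=
    (Equiv.sum_comp (Equiv.addRight (1 : ZMod M)) fun i => a i * b i).symm
  have h3 : ∑ i, (a (i + 1) + a (i - 1) - 2 * a i) * b i =
      ∑ i, a (i + 1) * b i + ∑ i, a (i - 1) * b i - ∑ i, a i * b i - ∑ i, a i * b i := by
    rw [← Finset.sum_add_distrib, ← Finset.sum_sub_distrib, ← Finset.sum_sub_distrib]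
    exact Finset.sum_congr rfl fun i _ => by ring
  rw [h3, h1]
  nth_rewrite 1 [h2]
  rw [← Finset.sum_add_distrib, ← Finset.sum_sub_distrib, ← Finset.sum_sub_distrib,
    ← Finset.sum_neg_distrib]
  exact Finset.sum_congr rfl fun i _ => by ring

lemma gridInner_discreteLaplacian (v w : Grid M) :
    gridInner L (discreteLaplacian L v) w =
      -(gridInner L (discreteGradX L v) (discreteGradX L w) +
        gridInner L (discreteGradY L v) (discreteGradY L w)) := by
  have hX : ∑ i, ∑ j, (v (i + 1) j + v (i - 1) j - 2 * v i j) * w i j =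
      -∑ i, ∑ j, (v (i + 1) j - v i j) * (w (i + 1) j - w i j) := by
    rw [Finset.sum_comm, Finset.sum_comm (f := fun i j => (v (i + 1) j - v i j) * _),
      ← Finset.sum_neg_distrib]
    exact Finset.sum_congr rfl fun j _ => sum_secondDiff_mul (fun i => v i j) fun i => w i j
  have hY : ∑ i, ∑ j, (v i (j + 1) + v i (j - 1) - 2 * v i j) * w i j =
      -∑ i, ∑ j, (v i (j + 1) - v i j) * (w i (j + 1) - w i j) := by
    rw [← Finset.sum_neg_distrib]
    exact Finset.sum_congr rfl fun i _ => sum_secondDiff_mul (v i) (w i)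
  have hL : ∑ i, ∑ j, discreteLaplacian L v i j * w i j = 1 / meshSize L M ^ 2 *
      (∑ i, ∑ j, (v (i + 1) j + v (i - 1) j - 2 * v i j) * w i j +
        ∑ i, ∑ j, (v i (j + 1) + v i (j - 1) - 2 * v i j) * w i j) := by
    simp only [← Finset.sum_add_distrib, Finset.mul_sum, discreteLaplacian]
    exact Finset.sum_congr rfl fun i _ => Finset.sum_congr rfl fun j _ => by ring
  have hGX : ∑ i, ∑ j, discreteGradX L v i j * discreteGradX L w i j = 1 / meshSize L M ^ 2 *
      ∑ i, ∑ j, (v (i + 1) j - v i j) * (w (i + 1) j - w i j) := by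
    simp only [Finset.mul_sum, discreteGradX]
    exact Finset.sum_congr rfl fun i _ => Finset.sum_congr rfl fun j _ => by ring
  have hGY : ∑ i, ∑ j, discreteGradY L v i j * discreteGradY L w i j = 1 / meshSize L M ^ 2 *
      ∑ i, ∑ j, (v i (j + 1) - v i j) * (w i (j + 1) - w i j) := by
    simp only [Finset.mul_sum, discreteGradY]
    exact Finset.sum_congr rfl fun i _ => Finset.sum_congr rfl fun j _ => by ring
  rw [gridInner, gridInner, gridInner, hL, hGX, hGY, hX, hY]
  ring

/-- A weighted value biased to the new level dominates half the increment of the square. -/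
lemma half_sub_le_gridInner_weighted {s : ℝ} (hs : s ≤ 1 / 2) (a b : Grid M) :
    (gridInner L a a - gridInner L b b) / 2 ≤ gridInner L ((1 - s) • a + s • b) (a - b) := by
  have h := gridInner_self_nonneg L (a - b)
  have hr : ∀ u : Grid M, gridInner L u (a - b) = gridInner L u a - gridInner L u b := by
    intro u
    rw [gridInner_comm, gridInner_sub_left, gridInner_comm L a, gridInner_comm L b]
  rw [gridInner_sub_left, hr, hr, gridInner_comm L b a] at h
  rw [gridInner_add_left, gridInner_smul_left, gridInner_smul_left, hr, hr, gridInner_comm L b a]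
  -- The difference of the two sides is `(1 / 2 - s)` times the squared norm of `a - b`.
  nlinarith

lemma gridInner_discreteLaplacian_weighted_le {s : ℝ} (hs : s ≤ 1 / 2) (a b : Grid M) :
    gridInner L (discreteLaplacian L (weighted s a b)) (a - b) ≤
      -((gradNormSq L a - gradNormSq L b) / 2) := by
  rw [gridInner_discreteLaplacian, discreteGradX_weighted, discreteGradY_weighted,
    discreteGradX_sub, discreteGradY_sub]
  have h1 := half_sub_le_gridInner_weighted L hs (discreteGradX L a) (discreteGradX L b)
  have h2 := half_sub_le_gridInner_weighted L hs (discreteGradY L a) (discreteGradY L b)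
  simp only [gradNormSq]
  linarith

end grid

/-! ### Energy dissipation. -/

/-- Positive semidefiniteness of the discrete fractional derivative. -/
lemma sum_gridInner_fracDeriv_nonneg {α L : ℝ} {M N : ℕ} [NeZero M] {t : ℕ → ℝ}
    (ht : IsTimeMesh N t) (hα₀ : 0 < α) (hα₁ : α < 1)
    (hratio : ∀ k, 2 ≤ k → k ≤ N → 4 / 7 ≤ ratio t k) (φ : ℕ → Grid M) :
    0 ≤ ∑ n ∈ Finset.range N,
      gridInner L (fracDeriv α t φ (n + 1)) (φ (n + 1) - φ n) := by
  have hterm : ∀ n i j, fracDeriv α t φ (n + 1) i j * (φ (n + 1) - φ n) i j =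
      (φ (n + 1) i j - φ n i j) * ∑ k ∈ Finset.range (n + 1),
        kernelB α t (n + 1) (k + 1) * (φ (k + 1) i j - φ k i j) := by
    intro n i j
    have : fracDeriv α t φ (n + 1) i j = ∑ k ∈ Finset.range (n + 1),
        kernelB α t (n + 1) (k + 1) * (φ (k + 1) i j - φ k i j) := by
      rw [fracDeriv, Finset.sum_apply, Finset.sum_apply, ← Finset.Ico_add_one_right_eq_Icc,
        Finset.sum_Ico_eq_sum_range]
      refine Finset.sum_congr (by simp) fun k _ => ?_
      simp [add_comm 1 k]
    rw [this, mul_comm]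
    rfl
  simp only [gridInner, hterm]
  rw [← Finset.mul_sum, Finset.sum_comm]
  refine mul_nonneg (sq_nonneg _) (Finset.sum_nonneg fun i _ => ?_)
  -- With the time sum innermost, the scalar kernel inequality applies at each grid point.
  rw [Finset.sum_comm]
  exact Finset.sum_nonneg fun j _ =>
    sum_kernelB_nonneg ht hα₀ hα₁ hratio fun n => φ (n + 1) i j - φ n i j

/-- The energy increment of one step is bounded by the work of the fractional derivative. -/
lemma IsUnbalancedSolution.energy_step {α m ε β κ L : ℝ} {F f V : ℝ → ℝ} {M : ℕ} [NeZero M]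
    {N : ℕ} {t : ℕ → ℝ} {φhat φ : ℕ → Grid M} {R : ℕ → ℝ}
    (hsol : IsUnbalancedSolution α m ε β κ L F f V N t φhat φ R) (hα₁ : α < 1) (hm : 0 < m)
    (ht : IsTimeMesh N t) {n : ℕ} (hn : n < N) :
    modifiedEnergy L ε (φ (n + 1)) (R (n + 1)) +
        1 / m * gridInner L (fracDeriv α t φ (n + 1)) (φ (n + 1) - φ n) ≤
      modifiedEnergy L ε (φ n) (R n) := by
  have hτ := ht.step_pos (show 1 ≤ n + 1 by omega) hn
  have haux := hsol.aux_eq (n + 1) (by omega) hn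
  have hphase := congrArg (fun u => gridInner L u (φ (n + 1) - φ n))
    (hsol.phase_eq (n + 1) (by omega) hn)
  have hlap := gridInner_discreteLaplacian_weighted_le L (show α / 2 ≤ 1 / 2 by linarith)
    (φ (n + 1)) (φ n)
  simp only [gridInner_smul_left, gridInner_add_left,
    gridInner_sub_left L (_ + _)] at hphase
  simp only [gridInner_smul_right, Nat.add_sub_cancel] at haux
  rw [div_eq_iff hτ.ne'] at haux
  rw [hphase]
  simp only [modifiedEnergy]
  change gridInner L (discreteLaplacian L (solMid α φ (n + 1))) _ ≤ _ at hlap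
  have hlap' := mul_le_mul_of_nonneg_left hlap (sq_nonneg ε)
  -- The `V`, `f` and `κ` terms in the tested phase equation are the negatives of those in the
  -- increment of `R`; only the Laplacian term survives.
  field_simp at haux ⊢
  linarith

end SESAV

theorem mainTheorem6
    (α m ε β κ L : ℝ) (hα₀ : 0 < α) (hα₁ : α < 1) (hm : 0 < m) (hε : 0 < ε) (hL : 0 < L)
    (D : Set ℝ) (F f V : ℝ → ℝ) (hF : SESAV.IsPotential D F f β) (hV : SESAV.IsAuxiliary V 1)
    (hκ₀ : 0 ≤ κ) (hκ : ∀ x ∈ Set.Icc (-β) β, |deriv f x| ≤ κ)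
    (M : ℕ) [NeZero M] (N : ℕ) (t : ℕ → ℝ) (ht : SESAV.IsTimeMesh N t)
    (hratio : ∀ k, 2 ≤ k → k ≤ N → 4 / 7 ≤ SESAV.ratio t k)
    (hτ₁ : SESAV.step t 1 ≤
      (4 / (11 * (α / 2) * m * (κ + 4 * ε ^ 2 / SESAV.meshSize L M ^ 2) *
        Real.Gamma (2 - α))) ^ (1 / α))
    (hτ₁' : 0 < κ → SESAV.step t 1 ≤
      (4 / (11 * κ * (1 - α / 2) * m * Real.Gamma (2 - α))) ^ (1 / α))
    (φhat φ : ℕ → SESAV.Grid M) (R : ℕ → ℝ)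
    (hsol : SESAV.IsUnbalancedSolution α m ε β κ L F f V N t φhat φ R) :
    ∀ n, 1 ≤ n → n ≤ N →
      SESAV.modifiedEnergy L ε (φ n) (R n) ≤ SESAV.modifiedEnergy L ε (φ 0) (R 0) := by
  intro n _ hn
  have htele : ∀ k, k ≤ N → SESAV.modifiedEnergy L ε (φ k) (R k) +
      1 / m * ∑ j ∈ Finset.range k,
        SESAV.gridInner L (SESAV.fracDeriv α t φ (j + 1)) (φ (j + 1) - φ j) ≤
      SESAV.modifiedEnergy L ε (φ 0) (R 0) := by
    intro k
    induction k with
    | zero => intro _; simp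
    | succ k ih =>
      intro hk
      rw [Finset.sum_range_succ, mul_add]
      linarith [ih (by omega), hsol.energy_step hα₁ hm ht hk]
  -- Positivity is applied to the mesh truncated at level `n`, since the telescoped sum stops there.
  have hpos := SESAV.sum_gridInner_fracDeriv_nonneg (L := L) (N := n)
    ⟨ht.1, fun k h1 hk => ht.2 k h1 (hk.trans hn)⟩ hα₀ hα₁
    (fun k h2 hk => hratio k h2 (hk.trans hn)) φ
  have := mul_nonneg (one_div_pos.2 hm).le hpos
  linarith [htele n hn]
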